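/- Let $r\ge 0$ be an integer and $[r]=\{1,\dots,r\}$. For $F\subseteq[r]$ let $\Delta_F=\{x\in\mathbb R^r : x_i\ge 0 \text{ for all } i,\ \sum_i x_i=1,\ x_i=0 \text{ for } i\notin F\}$, and for a finite family $\mathcal F=(F_1,\dots,F_k)$ of subsets of $[r]$ (with $k\ge 0$, repetitions allowed) let $P_{\mathcal F}=\Delta_{F_1}+\cdots+\Delta_{F_k}$ be the Minkowski sum, with $P_{\mathcal F}=\{0\}$ for $k=0$. A face of $P_{\mathcal F}$ is a nonempty subset on which some linear functional attains its maximum over $P_{\mathcal F}$; the vertices of $P_{\mathcal F}$ are its one-point faces, two distinct vertices are adjacent if the segment joining them is a face, and the degree of a vertex is the number of vertices adjacent to it. (If some $F_i$ is empty, then $P_{\mathcal F}$ is empty and has no vertices.) Then the maximum degree of a vertex of $P_{\mathcal F}$, over all finite families $\mathcal F$ of subsets of $[r]$ and all vertices of $P_{\mathcal F}$, is exactly $$d(r)=\left\lfloor \frac{r^2}{4}\right\rfloor .$$ Moreover, it is attained for $k=\lfloor r/2\rfloor$ and the family $F_i=\{i,k+1,k+2,\dots,r\}$, $1\le i\le k$,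 at the vertex $e_1+\cdots+e_k$ of $P_{\mathcal F}$, where $e_1,\dots,e_r$ is the standard basis of $\mathbb R^r$. -/

import Mathlib

open scoped Pointwise

namespace MinkowskiSimplices

/-- The face `Δ_F = {x ∈ Δ_[r] : x_i = 0 for i ∉ F}` of the standard simplex in `ℝ^r`
(it is empty when `F` is empty). The ground set `[r]` is `Fin r`. -/
def simplexFace {r : ℕ} (F : Finset (Fin r)) : Set (Fin r → ℝ) :=
  {x | x ∈ stdSimplex ℝ (Fin r) ∧ ∀ i, i ∉ F → x i = 0}

/-- The Minkowski sum `P_𝓕 = Δ_{F_1} + ⋯ + Δ_{F_k}` of a finite family of subsets of `[r]`,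
repetitions allowed. The sum of the empty family is `{0}`. -/
def sumPolytope {r k : ℕ} (F : Fin k → Finset (Fin r)) : Set (Fin r → ℝ) :=
  ∑ i, simplexFace (F i)

/-- The edge graph of a polytope `P ⊆ ℝ^r`. Faces are the subsets of `P` on which a linear
functional is maximized, i.e. Mathlib's `IsExposed`. The vertices of the graph are the vertices
of `P` (points that form a face), and two distinct vertices are adjacent when the segment
joining them is a face of `P`. -/
def edgeGraph {r : ℕ} (P : Set (Fin r → ℝ)) : SimpleGraph (P.exposedPoints ℝ) where
  Adj u v := u ≠ v ∧ IsExposed ℝ P (segment ℝ (u : Fin r → ℝ) (v : Fin r → ℝ))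
  symm := ⟨fun u v h => ⟨h.1.symm, by rw [segment_symm]; exact h.2⟩⟩
  loopless := ⟨fun _ h => h.1 rfl⟩

/-- The degree of a vertex of `P` in the edge graph, as a number in `ℕ ∪ {∞}`. -/
noncomputable def vertexDegree {r : ℕ} (P : Set (Fin r → ℝ)) (v : P.exposedPoints ℝ) : ℕ∞ :=
  ((edgeGraph P).neighborSet v).encard

/-- The family `F_i = {i, k+1, …, r}`, `i = 1, …, k`, of subsets of `[r]`
(elements of `[r]` and indices are numbered from `0` here). -/
def extremalFamily (r k : ℕ) (i : Fin k) : Finset (Fin r) :=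
  {j | (j : ℕ) = (i : ℕ) ∨ k ≤ (j : ℕ)}

/-- The point `e_1 + ⋯ + e_k` of `ℝ^r`. -/
def extremalPoint (r k : ℕ) : Fin r → ℝ :=
  fun j => if (j : ℕ) < k then 1 else 0

end MinkowskiSimplices

namespace MinkowskiSimplices

open Finset

variable {r k : ℕ}

/-- The sum `∑ i, e_{a i}` of the standard basis vectors selected by `a`. -/
def selectionSum (a : Fin k → Fin r) : Fin r → ℝ :=
  ∑ i, Pi.single (a i) (1 : ℝ)

/-- The continuous linear functional `x ↦ c ⬝ᵥ x`. -/
def dotFunctional (c : Fin r → ℝ) : StrongDual ℝ (Fin r → ℝ) :=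
  ∑ j, c j • ContinuousLinearMap.proj j

theorem dotFunctional_apply (c x : Fin r → ℝ) : dotFunctional c x = c ⬝ᵥ x := by
  simp [dotFunctional, dotProduct]

theorem exists_eq_dotProduct (l : StrongDual ℝ (Fin r → ℝ)) :
    ∃ c : Fin r → ℝ, ∀ x, l x = c ⬝ᵥ x := by
  refine ⟨fun j => l (Pi.single j 1), fun x => ?_⟩
  have hx : x = ∑ j, x j • (Pi.single j (1 : ℝ) : Fin r → ℝ) := by
    ext m
    simp [Finset.sum_apply, Pi.single_apply]
  conv_lhs => rw [hx, map_sum]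
  simp [dotProduct, mul_comm]

theorem mem_sumPolytope {F : Fin k → Finset (Fin r)} {x : Fin r → ℝ} :
    x ∈ sumPolytope F ↔ ∃ y : Fin k → Fin r → ℝ, (∀ i, y i ∈ simplexFace (F i)) ∧ ∑ i, y i = x := by
  rw [sumPolytope, Set.mem_fintype_sum]
  simp only [exists_prop]

theorem single_mem_simplexFace {G : Finset (Fin r)} {j : Fin r} (hj : j ∈ G) :
    Pi.single j (1 : ℝ) ∈ simplexFace G := by
  refine ⟨single_mem_stdSimplex ℝ j, fun i hi => ?_⟩
  exact Pi.single_eq_of_ne (by rintro rfl; exact hi hj) _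

theorem selectionSum_mem {F : Fin k → Finset (Fin r)} {a : Fin k → Fin r}
    (ha : ∀ i, a i ∈ F i) : selectionSum a ∈ sumPolytope F :=
  mem_sumPolytope.2 ⟨_, fun i => single_mem_simplexFace (ha i), rfl⟩

theorem dotProduct_selectionSum (c : Fin r → ℝ) (a : Fin k → Fin r) :
    c ⬝ᵥ selectionSum a = ∑ i, c (a i) := by
  simp [selectionSum, dotProduct_sum]

theorem selectionSum_update (a : Fin k → Fin r) (i : Fin k) (j : Fin r) :
    selectionSum (Function.update a i j) =
      selectionSum a + (Pi.single j 1 - Pi.single (a i) 1) := by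
  unfold selectionSum
  rw [← Finset.add_sum_erase _ _ (mem_univ i), ← Finset.add_sum_erase univ
    (fun m => (Pi.single (a m) (1 : ℝ) : Fin r → ℝ)) (mem_univ i), Function.update_self]
  rw [Finset.sum_congr rfl (g := fun m => (Pi.single (a m) (1 : ℝ) : Fin r → ℝ))]
  · abel
  · intro m hm
    rw [Function.update_of_ne (Finset.ne_of_mem_erase hm)]

theorem update_mem {F : Fin k → Finset (Fin r)} {a : Fin k → Fin r}
    (ha : ∀ i, a i ∈ F i) {i : Fin k} {j : Fin r} (hj : j ∈ F i) (m : Fin k) :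
    Function.update a i j m ∈ F m := by
  by_cases h : m = i
  · subst h; simpa using hj
  · simpa [Function.update_of_ne h] using ha m

/-- Moving one summand of a selection inside its simplex stays in the Minkowski sum. -/
theorem selectionSum_add_mem {F : Fin k → Finset (Fin r)} {a : Fin k → Fin r}
    (ha : ∀ i, a i ∈ F i) {i : Fin k} {j : Fin r} (hj : j ∈ F i) :
    selectionSum a + (Pi.single j 1 - Pi.single (a i) 1) ∈ sumPolytope F :=
  selectionSum_update a i j ▸ selectionSum_mem (update_mem ha hj)

theorem dotProduct_le_of_mem_simplexFace {G : Finset (Fin r)} {c x : Fin r → ℝ} {M : ℝ}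
    (hM : ∀ j ∈ G, c j ≤ M) (hx : x ∈ simplexFace G) : c ⬝ᵥ x ≤ M := by
  calc c ⬝ᵥ x ≤ ∑ j, M * x j := by
        refine Finset.sum_le_sum fun j _ => ?_
        by_cases hj : j ∈ G
        · exact mul_le_mul_of_nonneg_right (hM j hj) (hx.1.1 j)
        · simp [hx.2 j hj]
    _ = M := by rw [← Finset.mul_sum, hx.1.2, mul_one]

/-- A point of a simplex that maximizes a functional is supported on the maximizing coordinates. -/
theorem eq_zero_of_dotProduct_eq {G : Finset (Fin r)} {c x : Fin r → ℝ} {M : ℝ}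
    (hM : ∀ j ∈ G, c j ≤ M) (hx : x ∈ simplexFace G) (h : c ⬝ᵥ x = M) {j : Fin r}
    (hj : j ∈ G → c j < M) : x j = 0 := by
  by_cases hjG : j ∈ G
  swap
  · exact hx.2 j hjG
  have h0 : ∑ m, (M - c m) * x m = 0 := by
    simp only [sub_mul, Finset.sum_sub_distrib, ← Finset.mul_sum, hx.1.2]
    rw [dotProduct] at h
    linarith
  have hnn : ∀ m ∈ univ, 0 ≤ (M - c m) * x m := by
    intro m _
    by_cases hm : m ∈ G
    · exact mul_nonneg (sub_nonneg.2 (hM m hm)) (hx.1.1 m)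
    · simp [hx.2 m hm]
  have := (Finset.sum_eq_zero_iff_of_nonneg hnn).1 h0 j (mem_univ j)
  rcases mul_eq_zero.1 this with h' | h'
  · linarith [hj hjG]
  · exact h'

theorem dotProduct_le_selectionSum {F : Fin k → Finset (Fin r)} {a : Fin k → Fin r}
    {c x : Fin r → ℝ} (hc : ∀ i, ∀ j ∈ F i, c j ≤ c (a i)) (hx : x ∈ sumPolytope F) :
    c ⬝ᵥ x ≤ c ⬝ᵥ selectionSum a := by
  obtain ⟨y, hy, rfl⟩ := mem_sumPolytope.1 hx
  rw [dotProduct_selectionSum, dotProduct_sum]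
  exact Finset.sum_le_sum fun i _ => dotProduct_le_of_mem_simplexFace (hc i) (hy i)

theorem dotProduct_summand_eq {F : Fin k → Finset (Fin r)} {a : Fin k → Fin r}
    {c : Fin r → ℝ} (hc : ∀ i, ∀ j ∈ F i, c j ≤ c (a i)) {y : Fin k → Fin r → ℝ}
    (hy : ∀ i, y i ∈ simplexFace (F i)) (h : c ⬝ᵥ selectionSum a ≤ c ⬝ᵥ ∑ i, y i) (i : Fin k) :
    c ⬝ᵥ y i = c (a i) := by
  have hle : ∀ i ∈ univ, c ⬝ᵥ y i ≤ c (a i) := fun i _ =>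
    dotProduct_le_of_mem_simplexFace (hc i) (hy i)
  rw [dotProduct_selectionSum, dotProduct_sum] at h
  exact (Finset.sum_eq_sum_iff_of_le hle).1 (le_antisymm (Finset.sum_le_sum hle) h) i (mem_univ i)

theorem eq_single_of_mem_simplexFace {G : Finset (Fin r)} {x : Fin r → ℝ} {j : Fin r}
    (hx : x ∈ simplexFace G) (h : ∀ m, m ≠ j → x m = 0) : x = Pi.single j 1 := by
  have hj : x j = 1 := by
    rw [← hx.1.2]
    exact (Finset.sum_eq_single j (fun m _ hm => h m hm) (by simp)).symm
  ext m
  by_cases hm : m = j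
  · subst hm; simp [hj]
  · rw [h m hm, Pi.single_eq_of_ne hm]

/-- A selection that strictly maximizes a functional on every simplex is a vertex. -/
theorem selectionSum_mem_exposedPoints {F : Fin k → Finset (Fin r)} {a : Fin k → Fin r}
    {c : Fin r → ℝ} (ha : ∀ i, a i ∈ F i) (hc : ∀ i, ∀ j ∈ F i, j ≠ a i → c j < c (a i)) :
    selectionSum a ∈ (sumPolytope F).exposedPoints ℝ := by
  have hc' : ∀ i, ∀ j ∈ F i, c j ≤ c (a i) := fun i j hj => by
    by_cases h : j = a i
    · rw [h]
    · exact (hc i j hj h).le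
  refine ⟨selectionSum_mem ha, dotFunctional c, fun x hx => ?_⟩
  simp only [dotFunctional_apply]
  refine ⟨dotProduct_le_selectionSum hc' hx, fun h => ?_⟩
  obtain ⟨y, hy, rfl⟩ := mem_sumPolytope.1 hx
  refine Finset.sum_congr rfl fun i _ => eq_single_of_mem_simplexFace (hy i) fun m hm => ?_
  exact eq_zero_of_dotProduct_eq (hc' i) (hy i) (dotProduct_summand_eq hc' hy h i)
    fun hmF => hc i m hmF hm

/-- A functional with exactly one tie, in one summand, exposes an edge. -/
theorem isExposed_segment {F : Fin k → Finset (Fin r)} {a : Fin k → Fin r} {c : Fin r → ℝ}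
    (ha : ∀ i, a i ∈ F i) {i₀ : Fin k} {j₀ : Fin r} (hj₀ : j₀ ∈ F i₀) (hne : j₀ ≠ a i₀)
    (htie : c j₀ = c (a i₀))
    (hc : ∀ i, ∀ j ∈ F i, j ≠ a i → ¬(i = i₀ ∧ j = j₀) → c j < c (a i)) :
    IsExposed ℝ (sumPolytope F) (segment ℝ (selectionSum a)
      (selectionSum a + (Pi.single j₀ 1 - Pi.single (a i₀) 1))) := by
  have hc' : ∀ i, ∀ j ∈ F i, c j ≤ c (a i) := fun i j hj => by
    by_cases h : j = a i
    · rw [h]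
    by_cases h' : i = i₀ ∧ j = j₀
    · rw [h'.1, h'.2, htie]
    · exact (hc i j hj h h').le
  intro _
  refine ⟨dotFunctional c, Set.ext fun x => ?_⟩
  simp only [dotFunctional_apply, Set.mem_ofPred_eq]
  rw [segment_eq_image']
  constructor
  · rintro ⟨t, ht, rfl⟩
    simp only [add_sub_cancel_left]
    constructor
    · refine mem_sumPolytope.2 ⟨fun i => Pi.single (a i) 1 +
        if i = i₀ then t • (Pi.single j₀ 1 - Pi.single (a i₀) 1) else 0, fun i => ?_, ?_⟩
      · by_cases hi : i = i₀
        · subst hi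
          have hconv : Convex ℝ (simplexFace (F i)) := by
            intro x hx y hy p q hp hq hpq
            refine ⟨convex_stdSimplex ℝ _ hx.1 hy.1 hp hq hpq, fun m hm => ?_⟩
            simp [hx.2 m hm, hy.2 m hm]
          have := hconv.add_smul_sub_mem (single_mem_simplexFace (ha i))
            (single_mem_simplexFace hj₀) ht
          simpa using this
        · simpa [hi] using single_mem_simplexFace (ha i)
      · simp [Finset.sum_add_distrib, selectionSum]
    · intro y hy
      refine (dotProduct_le_selectionSum hc' hy).trans (le_of_eq ?_)
      simp [dotProduct_add, dotProduct_sub, htie]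
  · rintro ⟨hx, hmax⟩
    have h := hmax _ (selectionSum_mem ha)
    obtain ⟨y, hy, rfl⟩ := mem_sumPolytope.1 hx
    have hzero : ∀ i m, m ≠ a i → ¬(i = i₀ ∧ m = j₀) → y i m = 0 := fun i m hm hm' =>
      eq_zero_of_dotProduct_eq (hc' i) (hy i) (dotProduct_summand_eq hc' hy h i)
        fun hmF => hc i m hmF hm hm'
    have hsum : y i₀ (a i₀) + y i₀ j₀ = 1 := by
      rw [← (hy i₀).1.2, Finset.sum_eq_add (a i₀) j₀ hne.symm]
      · intro m _ hm
        exact hzero i₀ m hm.1 fun h => hm.2 h.2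
      · simp
      · simp
    have h₀ := (hy i₀).1.1 (a i₀)
    have h₁ := (hy i₀).1.1 j₀
    refine ⟨y i₀ j₀, ⟨h₁, by linarith⟩, ?_⟩
    have hy₀ : ∀ i, y i = Pi.single (a i) 1 +
        if i = i₀ then y i₀ j₀ • (Pi.single j₀ 1 - Pi.single (a i₀) 1) else 0 := by
      intro i
      by_cases hi : i = i₀
      · subst hi
        ext m
        by_cases hm : m = a i
        · subst hm
          simp [Pi.single_eq_of_ne hne.symm]
          linarith
        by_cases hm' : m = j₀
        · subst hm'
          simp [Pi.single_eq_of_ne hne]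
        · simp [Pi.single_eq_of_ne hm, Pi.single_eq_of_ne hm', hzero i m hm fun h => hm' h.2]
      · simp only [hi, if_false, add_zero]
        exact eq_single_of_mem_simplexFace (hy i) fun m hm => hzero i m hm fun h => hi h.1
    rw [Finset.sum_congr rfl fun i _ => hy₀ i]
    simp [Finset.sum_add_distrib, selectionSum]

/-- A vertex of the Minkowski sum is a sum of vertices, selected by strict maximization. -/
theorem exists_selection_of_mem_exposedPoints {F : Fin k → Finset (Fin r)} {v : Fin r → ℝ}
    (hv : v ∈ (sumPolytope F).exposedPoints ℝ) :
    ∃ (a : Fin k → Fin r) (c : Fin r → ℝ), v = selectionSum a ∧ (∀ i, a i ∈ F i) ∧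
      ∀ i, ∀ j ∈ F i, j ≠ a i → c j < c (a i) := by
  obtain ⟨hvP, l, hl⟩ := hv
  obtain ⟨c, hc⟩ := exists_eq_dotProduct l
  simp only [hc] at hl
  have hne : ∀ i, (F i).Nonempty := by
    obtain ⟨y, hy, -⟩ := mem_sumPolytope.1 hvP
    intro i
    by_contra h
    rw [Finset.not_nonempty_iff_eq_empty] at h
    have h1 := (hy i).1.2
    rw [Finset.sum_eq_zero fun j _ => (hy i).2 j (by simp [h])] at h1
    exact zero_ne_one h1
  choose a ha hmax using fun i => Finset.exists_max_image (F i) c (hne i)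
  have hva : selectionSum a = v :=
    (hl _ (selectionSum_mem ha)).2 (dotProduct_le_selectionSum hmax hvP)
  refine ⟨a, c, hva.symm, ha, fun i j hj hja => lt_of_le_of_ne (hmax i j hj) fun h => hja ?_⟩
  have h1 := (hl _ (selectionSum_add_mem ha hj)).2 (by
    simp [dotProduct_add, dotProduct_sub, h, hva])
  rw [hva, add_eq_left, sub_eq_zero] at h1
  by_contra hja'
  have := congrFun h1 j
  simp [Pi.single_eq_of_ne hja'] at this

/-- `e_q - e_p` is the direction of an edge at `selectionSum a` of one of the simplices. -/
def Arc (F : Fin k → Finset (Fin r)) (a : Fin k → Fin r) (p q : Fin r) : Prop :=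
  ∃ i, a i = p ∧ q ∈ F i ∧ q ≠ p

/-- An arc that is not the composition of two arcs. -/
def IrreducibleArc (F : Fin k → Finset (Fin r)) (a : Fin k → Fin r) (p q : Fin r) : Prop :=
  Arc F a p q ∧ ∀ m, Arc F a p m → ¬Arc F a m q

theorem Arc.lt {F : Fin k → Finset (Fin r)} {a : Fin k → Fin r} {c : Fin r → ℝ}
    (hc : ∀ i, ∀ j ∈ F i, j ≠ a i → c j < c (a i)) {p q : Fin r} (h : Arc F a p q) :
    c q < c p := by
  obtain ⟨i, rfl, hq, hne⟩ := h
  exact hc i q hq hne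

/-- The undirected graph of irreducible arcs. -/
def irreducibleArcGraph (F : Fin k → Finset (Fin r)) (a : Fin k → Fin r) :
    SimpleGraph (Fin r) where
  Adj p q := IrreducibleArc F a p q ∨ IrreducibleArc F a q p
  symm := ⟨fun _ _ h => h.symm⟩
  loopless := ⟨fun _ h => by
    rcases h with ⟨⟨i, -, -, h⟩, -⟩ | ⟨⟨i, -, -, h⟩, -⟩ <;> exact h rfl⟩

theorem irreducibleArcGraph_cliqueFree {F : Fin k → Finset (Fin r)} {a : Fin k → Fin r}
    {c : Fin r → ℝ} (hc : ∀ i, ∀ j ∈ F i, j ≠ a i → c j < c (a i)) :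
    (irreducibleArcGraph F a).CliqueFree 3 := by
  intro s hs
  obtain ⟨x, y, z, hxy, hxz, hyz, -⟩ := SimpleGraph.is3Clique_iff.1 hs
  have key : ∀ p m q, IrreducibleArc F a p m → IrreducibleArc F a m q →
      IrreducibleArc F a p q → False := fun p m q h₁ h₂ h₃ => h₃.2 m h₁.1 h₂.1
  rcases hxy with h₁ | h₁ <;> rcases hxz with h₂ | h₂ <;> rcases hyz with h₃ | h₃
  · exact key _ _ _ h₁ h₃ h₂
  · exact key _ _ _ h₂ h₃ h₁
  · linarith [h₁.1.lt hc, h₂.1.lt hc, h₃.1.lt hc]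
  · exact key _ _ _ h₂ h₁ h₃
  · exact key _ _ _ h₁ h₂ h₃
  · linarith [h₁.1.lt hc, h₂.1.lt hc, h₃.1.lt hc]
  · exact key _ _ _ h₃ h₂ h₁
  · exact key _ _ _ h₃ h₁ h₂

/-- **Mantel's theorem**: a triangle-free graph on `r` vertices has at most `r ^ 2 / 4` edges. -/
theorem encard_edgeSet_le_of_cliqueFree (G : SimpleGraph (Fin r)) (hG : G.CliqueFree 3) :
    G.edgeSet.encard ≤ ((r ^ 2 / 4 : ℕ) : ℕ∞) := by
  classical
  have h := hG.card_edgeFinset_le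
  rw [← SimpleGraph.coe_edgeFinset, Set.encard_coe_eq_coe_finsetCard]
  simp only [Fintype.card_fin] at h
  norm_cast
  refine h.trans ?_
  rcases Nat.mod_two_eq_zero_or_one r with h2 | h2 <;> rw [h2]
  · simp
  · simp
    omega

/-- The direction of an edge at a vertex is an irreducible arc. -/
theorem exists_irreducibleArc {F : Fin k → Finset (Fin r)} {a : Fin k → Fin r}
    (ha : ∀ i, a i ∈ F i) {u : Fin r → ℝ}
    (hu : u ∈ (sumPolytope F).exposedPoints ℝ) (hne : u ≠ selectionSum a)
    (hseg : IsExposed ℝ (sumPolytope F) (segment ℝ (selectionSum a) u)) :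
    ∃ p q, IrreducibleArc F a p q ∧ ∃ s : ℝ, 0 < s ∧
      u = selectionSum a + s • (Pi.single q 1 - Pi.single p 1) := by
  obtain ⟨b, -, rfl, hb, -⟩ := exists_selection_of_mem_exposedPoints hu
  obtain ⟨l, hl⟩ := hseg ⟨_, left_mem_segment ℝ _ _⟩
  obtain ⟨c, hc⟩ := exists_eq_dotProduct l
  simp only [hc] at hl
  have hl' : ∀ x, x ∈ segment ℝ (selectionSum a) (selectionSum b) ↔
      x ∈ sumPolytope F ∧ ∀ y ∈ sumPolytope F, c ⬝ᵥ y ≤ c ⬝ᵥ x := fun x => by rw [hl]; rfl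
  have hav := (hl' _).1 (left_mem_segment ℝ _ _)
  have hbv := (hl' _).1 (right_mem_segment ℝ _ _)
  have hle : ∀ i, ∀ j ∈ F i, c j ≤ c (a i) := fun i j hj => by
    have := hav.2 _ (selectionSum_add_mem ha hj)
    simp only [dotProduct_add, dotProduct_sub, dotProduct_single_one] at this
    linarith
  have htie : ∀ i, c (b i) = c (a i) := fun i => by
    have := dotProduct_summand_eq hle (fun i => single_mem_simplexFace (hb i))
      (hbv.2 _ hav.1) i
    simpa using this
  have hmem : ∀ i, ∀ j ∈ F i, c j = c (a i) → ∃ t : ℝ, 0 ≤ t ∧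
      (Pi.single j 1 - Pi.single (a i) 1 : Fin r → ℝ) =
        t • (selectionSum b - selectionSum a) := by
    intro i j hj hcj
    have h := (hl' (selectionSum a + (Pi.single j 1 - Pi.single (a i) 1))).2
      ⟨selectionSum_add_mem ha hj, fun y hy => by
        simpa [dotProduct_add, dotProduct_sub, hcj] using hav.2 y hy⟩
    rw [segment_eq_image'] at h
    obtain ⟨t, ht, h⟩ := h
    exact ⟨t, ht.1, (add_left_cancel h).symm⟩
  obtain ⟨i, hi⟩ : ∃ i, b i ≠ a i := by
    by_contra! h
    exact hne (by rw [funext h])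
  obtain ⟨t, ht, htd⟩ := hmem i (b i) (hb i) (htie i)
  have ht0 : t ≠ 0 := by
    rintro rfl
    have := congrFun htd (b i)
    simp [Pi.single_eq_of_ne hi] at this
  refine ⟨a i, b i, ⟨⟨i, rfl, hb i, hi⟩, ?_⟩, t⁻¹, by positivity, ?_⟩
  · rintro m ⟨i₁, hi₁, hm, hma⟩ ⟨i₂, hi₂, hbm, hmb⟩
    have h₁ := hle i₁ m hm
    have h₂ := hle i₂ (b i) hbm
    rw [hi₁] at h₁
    rw [hi₂, htie i] at h₂
    obtain ⟨t', -, h'⟩ := hmem i₁ m hm (by rw [hi₁]; exact le_antisymm h₁ h₂)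
    have hdir : selectionSum b - selectionSum a =
        t⁻¹ • (Pi.single (b i) 1 - Pi.single (a i) 1 : Fin r → ℝ) := by
      rw [htd, smul_smul, inv_mul_cancel₀ ht0, one_smul]
    rw [hdir, hi₁] at h'
    have := congrFun h' m
    simp [Pi.single_eq_of_ne hma, Pi.single_eq_of_ne hmb.symm] at this
  · rw [htd, smul_smul, inv_mul_cancel₀ ht0, one_smul, add_sub_cancel]

/-- Two vertices on the same ray from a point of the polytope coincide. -/
theorem exposedPoints_eq_of_ray {P : Set (Fin r → ℝ)} {v d : Fin r → ℝ} (hv : v ∈ P) {s t : ℝ}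
    (hs : 0 < s) (ht : 0 < t) (h₁ : v + s • d ∈ P.exposedPoints ℝ)
    (h₂ : v + t • d ∈ P.exposedPoints ℝ) : v + s • d = v + t • d := by
  wlog hst : s < t generalizing s t
  · rcases eq_or_lt_of_le (not_lt.1 hst) with h | h
    · rw [h]
    · exact (this ht hs h₂ h₁ h).symm
  obtain ⟨-, l, hl⟩ := h₁
  have h₃ := (hl v hv).1
  have h₄ := hl _ h₂.1
  simp only [map_add, map_smul, smul_eq_mul] at h₃ h₄
  have h₅ : 0 ≤ l d := nonneg_of_mul_nonneg_right (by linarith) hs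
  exact (h₄.2 (by nlinarith)).symm

theorem vertexDegree_le (F : Fin k → Finset (Fin r)) (v : (sumPolytope F).exposedPoints ℝ) :
    vertexDegree (sumPolytope F) v ≤ ((r ^ 2 / 4 : ℕ) : ℕ∞) := by
  obtain ⟨v, hv⟩ := v
  obtain ⟨a, c, rfl, ha, hc⟩ := exists_selection_of_mem_exposedPoints hv
  refine le_trans ?_ (encard_edgeSet_le_of_cliqueFree _ (irreducibleArcGraph_cliqueFree hc))
  have hdir : ∀ u : (edgeGraph (sumPolytope F)).neighborSet ⟨selectionSum a, hv⟩,
      ∃ p q, IrreducibleArc F a p q ∧ ∃ s : ℝ, 0 < s ∧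
        (u : Fin r → ℝ) = selectionSum a + s • (Pi.single q 1 - Pi.single p 1) := by
    rintro ⟨⟨u, hu⟩, hne, hseg⟩
    exact exists_irreducibleArc ha hu (fun h => hne (Subtype.ext h.symm)) hseg
  choose p q hpq s hs hu using hdir
  refine Function.Embedding.encard_le ⟨fun u => ⟨s(p u, q u), Or.inl (hpq u)⟩, fun u u' h => ?_⟩
  have hpq' : p u = p u' ∧ q u = q u' := by
    rcases Sym2.eq_iff.1 (Subtype.ext_iff.1 h) with h | ⟨h, h'⟩
    · exact h
    · have h₁ := (hpq u).1.lt hc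
      have h₂ := (hpq u').1.lt hc
      rw [h, h'] at h₁
      exact absurd h₁ h₂.not_gt
  apply Subtype.ext
  apply Subtype.ext
  have e₁ := u.1.2
  have e₂ := u'.1.2
  rw [hu u] at e₁ ⊢
  rw [hu u', ← hpq'.1, ← hpq'.2] at e₂ ⊢
  exact exposedPoints_eq_of_ray (selectionSum_mem ha) (hs u) (hs u') e₁ e₂

/-- The selection `i ↦ i` for the extremal family. -/
def extremalSelection (h : k ≤ r) (i : Fin k) : Fin r := Fin.castLE h i

theorem selectionSum_extremalSelection (h : k ≤ r) :
    selectionSum (extremalSelection h) = extremalPoint r k := by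
  ext j
  simp only [selectionSum, Finset.sum_apply, extremalPoint, extremalSelection]
  split_ifs with hj
  · rw [Finset.sum_eq_single ⟨j, hj⟩]
    · exact Pi.single_eq_same _ _
    · intro i _ hi
      refine Pi.single_eq_of_ne (fun h' => hi ?_) _
      simp [h']
    · simp
  · refine Finset.sum_eq_zero fun i _ => Pi.single_eq_of_ne (fun h' => hj ?_) _
    simp [h']

theorem extremalSelection_mem (h : k ≤ r) (i : Fin k) :
    extremalSelection h i ∈ extremalFamily r k i := by
  simp [extremalFamily, extremalSelection]

theorem le_of_mem_extremalFamily (h : k ≤ r) {i : Fin k} {j : Fin r}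
    (hj : j ∈ extremalFamily r k i) (hne : j ≠ extremalSelection h i) : k ≤ (j : ℕ) := by
  simp only [extremalFamily, Finset.mem_filter, mem_univ, true_and] at hj
  rcases hj with hj | hj
  · exact absurd (Fin.ext hj) hne
  · exact hj

theorem extremalPoint_mem_exposedPoints (h : k ≤ r) :
    extremalPoint r k ∈ (sumPolytope (extremalFamily r k)).exposedPoints ℝ := by
  rw [← selectionSum_extremalSelection h]
  refine selectionSum_mem_exposedPoints (c := fun j => if (j : ℕ) < k then 1 else 0)
    (extremalSelection_mem h) fun i j hj hne => ?_
  have := le_of_mem_extremalFamily h hj hne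
  simp [extremalSelection, this.not_gt]

/-- The functional with value `4` on `[k]`, except for `1` at `i`, and `0` outside `[k]`, except for
`t` at `j`. -/
noncomputable def edgeWeight (k : ℕ) (i : Fin k) (j : Fin r) (t : ℝ) (m : Fin r) : ℝ :=
  if (m : ℕ) < k then (if (m : ℕ) = i then 1 else 4) else (if m = j then t else 0)

theorem mem_extremalFamily_of_le {i : Fin k} {j : Fin r} (hj : k ≤ (j : ℕ)) :
    j ∈ extremalFamily r k i := by
  simp [extremalFamily, hj]

theorem extremalNeighbor_mem_exposedPoints (h : k ≤ r) (i : Fin k) {j : Fin r}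
    (hj : k ≤ (j : ℕ)) :
    selectionSum (extremalSelection h) + (Pi.single j 1 - Pi.single (extremalSelection h i) 1) ∈
      (sumPolytope (extremalFamily r k)).exposedPoints ℝ := by
  rw [← selectionSum_update]
  refine selectionSum_mem_exposedPoints (c := edgeWeight k i j 2)
    (update_mem (extremalSelection_mem h) (mem_extremalFamily_of_le hj)) fun i' m hm hne => ?_
  by_cases hi : i' = i
  · subst hi
    rw [Function.update_self] at hne ⊢
    simp only [extremalFamily, Finset.mem_filter, mem_univ, true_and] at hm
    rcases hm with hm | hm
    · simp [edgeWeight, hm, hj.not_gt]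
    · simp [edgeWeight, hm.not_gt, hj.not_gt, hne]
  · rw [Function.update_of_ne hi] at hne ⊢
    have hm' := le_of_mem_extremalFamily h hm hne
    simp only [edgeWeight, extremalSelection, hm'.not_gt, if_false, Fin.val_castLE, i'.2, if_true,
      Fin.val_inj, hi]
    split_ifs <;> norm_num

theorem extremalNeighbor_isExposed_segment (h : k ≤ r) (i : Fin k) {j : Fin r}
    (hj : k ≤ (j : ℕ)) :
    IsExposed ℝ (sumPolytope (extremalFamily r k)) (segment ℝ (selectionSum (extremalSelection h))
      (selectionSum (extremalSelection h) +
        (Pi.single j 1 - Pi.single (extremalSelection h i) 1))) := by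
  refine isExposed_segment (c := edgeWeight k i j 1) (extremalSelection_mem h)
    (mem_extremalFamily_of_le hj) ?_ ?_ fun i' m hm hne hneg => ?_
  · rintro rfl
    exact absurd i.2 (not_lt.2 hj)
  · simp [edgeWeight, extremalSelection, hj.not_gt]
  · have hm' := le_of_mem_extremalFamily h hm hne
    simp only [edgeWeight, extremalSelection, hm'.not_gt, if_false, Fin.val_castLE, i'.2, if_true,
      Fin.val_inj]
    split_ifs with h₁ h₂ h₂
    · exact absurd ⟨h₂, h₁⟩ hneg
    all_goals norm_num

theorem le_vertexDegree_extremalPoint (h : k ≤ r) :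
    ((k * (r - k) : ℕ) : ℕ∞) ≤ vertexDegree (sumPolytope (extremalFamily r k))
      ⟨extremalPoint r k, extremalPoint_mem_exposedPoints h⟩ := by
  have hcard : ((k * (r - k) : ℕ) : ℕ∞) = (Set.univ : Set (Fin k × Fin (r - k))).encard := by
    simp [Set.encard_univ]
  rw [hcard]
  set T : Fin (r - k) → Fin r := fun y => ⟨k + y, by omega⟩ with hT
  have hTk : ∀ y, k ≤ (T y : ℕ) := fun y => Nat.le_add_right _ _
  have hST : ∀ i y, T y ≠ extremalSelection h i := fun i y he => by
    have := congrArg Fin.val he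
    simp [hT, extremalSelection] at this
    omega
  refine Set.encard_le_encard_of_injOn (f := fun z =>
    ⟨_, extremalNeighbor_mem_exposedPoints h z.1 (hTk z.2)⟩) ?_ ?_
  · rintro ⟨i, y⟩ -
    refine ⟨fun he => ?_, ?_⟩
    · have := congrFun (congrArg Subtype.val he) (T y)
      simp [selectionSum_extremalSelection, Pi.single_eq_of_ne (hST i y)] at this
    · simpa only [selectionSum_extremalSelection] using
        extremalNeighbor_isExposed_segment h i (hTk y)
  · rintro ⟨i, y⟩ - ⟨i', y'⟩ - he
    have he' := add_left_cancel (congrArg Subtype.val he)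
    have h₁ := congrFun he' (T y)
    have h₂ := congrFun he' (extremalSelection h i)
    simp only [Pi.sub_apply, Pi.single_eq_same, Pi.single_eq_of_ne (hST _ y),
      Pi.single_eq_of_ne (hST i _).symm] at h₁ h₂
    have hy : T y = T y' := by
      by_contra hne
      rw [Pi.single_eq_of_ne hne] at h₁
      norm_num at h₁
    have hi : extremalSelection h i = extremalSelection h i' := by
      by_contra hne
      rw [Pi.single_eq_of_ne hne] at h₂
      norm_num at h₂
    refine Prod.ext (Fin.castLE_injective h hi) (Fin.ext ?_)
    simpa [hT] using hy

theorem vertexDegree_extremalPoint (r : ℕ) :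
    vertexDegree (sumPolytope (extremalFamily r (r / 2)))
      ⟨extremalPoint r (r / 2), extremalPoint_mem_exposedPoints (Nat.div_le_self r 2)⟩ =
        ((r ^ 2 / 4 : ℕ) : ℕ∞) := by
  refine le_antisymm (vertexDegree_le _ _) (le_trans ?_
    (le_vertexDegree_extremalPoint (Nat.div_le_self r 2)))
  norm_cast
  obtain ⟨m, rfl | rfl⟩ := Nat.even_or_odd' r
  · rw [show 2 * m / 2 = m by omega, show 2 * m - m = m by omega,
      show (2 * m) ^ 2 = 4 * (m * m) by ring]
    omega
  · rw [show (2 * m + 1) / 2 = m by omega, show 2 * m + 1 - m = m + 1 by omega,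
      show (2 * m + 1) ^ 2 = 4 * (m * (m + 1)) + 1 by ring]
    omega

end MinkowskiSimplices

theorem mainTheorem1 (r : ℕ) :
    IsGreatest
      {d : ℕ∞ | ∃ (k : ℕ) (F : Fin k → Finset (Fin r))
        (v : (MinkowskiSimplices.sumPolytope F).exposedPoints ℝ),
        d = MinkowskiSimplices.vertexDegree (MinkowskiSimplices.sumPolytope F) v}
      ((r ^ 2 / 4 : ℕ) : ℕ∞) ∧
    ∃ v : (MinkowskiSimplices.sumPolytope
        (MinkowskiSimplices.extremalFamily r (r / 2))).exposedPoints ℝ,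
      (v : Fin r → ℝ) = MinkowskiSimplices.extremalPoint r (r / 2) ∧
      MinkowskiSimplices.vertexDegree (MinkowskiSimplices.sumPolytope
        (MinkowskiSimplices.extremalFamily r (r / 2))) v = ((r ^ 2 / 4 : ℕ) : ℕ∞) := by
  have h := MinkowskiSimplices.vertexDegree_extremalPoint r
  refine ⟨⟨⟨r / 2, _, _, h.symm⟩, ?_⟩, ⟨_, _⟩, rfl, h⟩
  rintro _ ⟨k, F, v, rfl⟩
  exact MinkowskiSimplices.vertexDegree_le F v
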